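/- For a finite group $G$, let $\mathsf{GEN}(G)$ be the impartial game in which two players alternately select previously unselected elements of $G$. The starting position is $\emptyset$, and the game ends as soon as the set of jointly selected elements generates $G$ (for trivial $G$, before the first move). The player who completes a generating set wins. Thus a position is a set $P\subseteq G$. It has no options if $\langle P\rangle=G$, and otherwise its options are the sets $P\cup\{g\}$ with $g\in G\setminus P$. The nim-number of a position is the least nonnegative integer that is not the nim-number of one of its options. We write $\mathsf{GEN}(G)=*n$ if the nim-number of the starting position is $n$. Let $d(G)=\min\{|S| : \langle S\rangle=G\}$, and let $\mathbb{Z}_n$ be the cyclic group of order $n$. **Theorem.** Let $G\cong T\times H$, where $T$ is a finite $2$-group and $H$ is a finite group of odd order. Then \[ \mathsf{GEN}(G)= \begin{cases} *1, & \text{if } |G| \text{ is odd and } d(G)\ge 3,\\ *1, & \text{if } G\cong\mathbb{Z}_{4k} \text{ for some } k\ge 1,\\ *1, & \text{if } G\cong\mathbb{Z}_2^2\times H \text{ and } d(H)\le 2,\\ *2, & \text{if } G\cong\mathbb{Z}_2,\\ *2, & \text{if } |G| \text{ is odd and } d(G)\in\{1,2\},\\ *4, & \text{if } G\cong\mathbb{Z}_{4k+2}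 \text{ for some } k\ge 1,\\ *0, & \text{otherwise.} \end{cases} \] Moreover, every finite nilpotent group $G$ is isomorphic to $T\times H$ for some subgroups $T,H\le G$ with $T$ a $2$-group and $|H|$ odd, so the formula applies to all finite nilpotent groups. -/

import Mathlib

namespace GenGame

/-- The minimal excludant: the least natural number that is not in `A`. It is only applied below to
finite sets `A`, whose complement is nonempty. -/
noncomputable def mex (A : Set ℕ) : ℕ := sInf Aᶜ

/-- The options of a position `P` (the set of elements selected so far) in the achievement game
`GEN(G)`: if `P` generates `G` then the game is over and there are none; otherwise the player to
move selects an element `g` that has not been selected before. -/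
def options {G : Type*} [Group G] (P : Set G) : Set (Set G) :=
  {Q | Subgroup.closure P ≠ ⊤ ∧ ∃ g : G, g ∉ P ∧ Q = insert g P}

theorem ncard_compl_lt_of_mem_options {G : Type*} [Group G] [Finite G] {P Q : Set G}
    (h : Q ∈ options P) : Qᶜ.ncard < Pᶜ.ncard := by
  obtain ⟨-, g, hg, rfl⟩ := h
  exact Set.ncard_lt_ncard (compl_lt_compl_iff_lt.2 (Set.ssubset_insert hg)) (Set.toFinite _)

/-- The nim-number (Sprague–Grundy value) of a position of `GEN(G)`: the minimal excludant of the
nim-numbers of its options. -/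
noncomputable def nim {G : Type*} [Group G] [Finite G] (P : Set G) : ℕ :=
  mex (Set.range fun Q : options P => nim Q.1)
termination_by Pᶜ.ncard
decreasing_by exact ncard_compl_lt_of_mem_options Q.2

/-- The nim-number of the game `GEN(G)`, that is, of its starting position, the empty set. -/
noncomputable def nimGEN (G : Type*) [Group G] [Finite G] : ℕ := nim (∅ : Set G)

/-- The cyclic group of order `n` (for `n ≥ 1`), written multiplicatively. -/
abbrev Z (n : ℕ) : Type := Multiplicative (ZMod n)

end GenGame

namespace GenGame

/-! ### Nim-numbers of positions -/

section Nim

/-! Let `hull P` be the subgroup generated by `P` and the Frattini subgroup. Selecting an element of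
the hull does not change how many further elements are needed to generate `G`; it only passes the
turn. If every position above a nongenerating `P` has a hull of the same parity, the game is
therefore decided by that number and by the parity of `P` (`nim_of_hull_parity`): if `P` and its
hull agree in parity, the value is 1 or 0 according to whether one more element suffices; otherwise
it is 2 or 1 according to whether two suffice.

This settles odd `|G|`, where all hulls are odd, and groups with even Frattini subgroup, where all
hulls are even. The latter occurs as soon as some `t : T` has `t * t ≠ 1`
(`even_card_frattini_prod`). What remains is a nontrivial elementary abelian `T`. There, positions
in `1 × H` must be analysed by hand, but any element with nontrivial `T`-component makes all later
hulls even, so moves out of `1 × H` have known values. As `|T|` and `|H|` are coprime, generation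
can be tested in each coordinate separately.

If `d(G) ≥ 3`, or `|T| = 2` and `H` is not cyclic, every first move has a nonzero value
(`nimGEN_prod_eq_zero`). Otherwise `T` has order 2 with `H` cyclic (`nim_of_card_two_of_isCyclic`),
or is a Klein four-group with `d(H) ≤ 2` (`nimGEN_prod_of_isKleinFour`). -/

theorem position_induction {α : Type*} [Finite α] {motive : Set α → Prop}
    (h : ∀ P, (∀ g ∉ P, motive (insert g P)) → motive P) (P : Set α) : motive P := by
  induction hn : Pᶜ.ncard using Nat.strong_induction_on generalizing P with
  | _ n ih =>
    refine h P fun g hg => ih _ ?_ _ rfl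
    rw [← hn]
    exact Set.ncard_lt_ncard (compl_lt_compl_iff_lt.2 (Set.ssubset_insert hg)) (Set.toFinite _)

theorem even_ncard_insert {α : Type*} [Finite α] {P : Set α} {g : α} (hg : g ∉ P) :
    Even (insert g P).ncard ↔ ¬ Even P.ncard := by
  rw [Set.ncard_insert_of_notMem hg (Set.toFinite _), Nat.even_add_one]

variable {G : Type*} [Group G] [Finite G] {P : Set G}

theorem mex_eq_of {A : Set ℕ} {n : ℕ} (h : ∀ m < n, m ∈ A) (hn : n ∉ A) : mex A = n :=
  le_antisymm (Nat.sInf_le hn) (not_lt.1 fun hlt =>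
    Nat.sInf_mem (s := Aᶜ) ⟨n, hn⟩ (h _ hlt))

theorem nim_of_closure_eq_top (h : Subgroup.closure P = ⊤) : nim P = 0 := by
  rw [nim]
  refine mex_eq_of (fun m hm => absurd hm (Nat.not_lt_zero m)) ?_
  rintro ⟨⟨Q, hQ⟩, -⟩
  exact hQ.1 h

theorem nim_insert_ne (h : Subgroup.closure P ≠ ⊤) {g : G} (hg : g ∉ P) :
    nim (insert g P) ≠ nim P := by
  have hfin : (Set.range fun Q : options P => nim Q.1).Finite :=
    Set.finite_range _
  have hmem := Nat.sInf_mem (s := (Set.range fun Q : options P => nim Q.1)ᶜ)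
    hfin.infinite_compl.nonempty
  intro he
  rw [nim.eq_1 P] at he
  exact hmem ⟨⟨insert g P, h, g, hg, rfl⟩, he⟩

theorem exists_nim_insert_eq_of_lt {m : ℕ} (hm : m < nim P) :
    Subgroup.closure P ≠ ⊤ ∧ ∃ g ∉ P, nim (insert g P) = m := by
  rw [nim] at hm
  have := Nat.notMem_of_lt_sInf hm
  rw [Set.notMem_compl_iff] at this
  obtain ⟨⟨Q, hQ, g, hg, rfl⟩, he⟩ := this
  exact ⟨hQ, g, hg, he⟩

theorem nim_eq_of (h : Subgroup.closure P ≠ ⊤) {n : ℕ}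
    (hlt : ∀ m < n, ∃ g ∉ P, nim (insert g P) = m)
    (hne : ∀ g ∉ P, nim (insert g P) ≠ n) : nim P = n := by
  rw [nim]
  refine mex_eq_of (fun m hm => ?_) ?_
  · obtain ⟨g, hg, he⟩ := hlt m hm
    exact ⟨⟨insert g P, h, g, hg, rfl⟩, he⟩
  · rintro ⟨⟨Q, _, g, hg, rfl⟩, he⟩
    exact hne g hg he

theorem nim_image {G' : Type*} [Group G'] [Finite G'] (e : G ≃* G') (P : Set G) :
    nim (e '' P) = nim P := by
  induction P using position_induction with
  | h P ih =>
    have hcl : Subgroup.closure (e '' P) = ⊤ ↔ Subgroup.closure P = ⊤ := by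
      have : Subgroup.closure (e '' P) = (Subgroup.closure P).map e.toMonoidHom :=
        (MonoidHom.map_closure e.toMonoidHom P).symm
      rw [this]
      constructor
      · intro h
        apply Subgroup.map_injective (f := e.toMonoidHom) e.injective
        rw [h, Subgroup.map_top_of_surjective _ e.surjective]
      · intro h
        rw [h, Subgroup.map_top_of_surjective _ e.surjective]
    by_cases h : Subgroup.closure P = ⊤
    · rw [nim_of_closure_eq_top h, nim_of_closure_eq_top (hcl.2 h)]
    · refine nim_eq_of (mt hcl.1 h) (fun m hm => ?_) (fun g hg => ?_)
      · obtain ⟨-, g, hg, he⟩ := exists_nim_insert_eq_of_lt hm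
        refine ⟨e g, fun h' => hg ((e.injective.mem_set_image).1 h'), ?_⟩
        rw [← Set.image_insert_eq, ih g hg, he]
      · obtain ⟨g, rfl⟩ := e.surjective g
        have hg' : g ∉ P := fun h' => hg (Set.mem_image_of_mem _ h')
        rw [← Set.image_insert_eq, ih g hg']
        exact nim_insert_ne h hg'

theorem nimGEN_congr {G' : Type*} [Group G'] [Finite G'] (e : G ≃* G') :
    nimGEN G = nimGEN G' := by
  rw [nimGEN, nimGEN, ← nim_image e, Set.image_empty]

end Nim

/-! ### Hulls, and the number of elements missing from a generating set -/

section Deficiency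

variable {G : Type*} [Group G]

/-- `GeneratesWith P k` means that adding at most `k` elements to `P` can produce a generating
set. -/
def GeneratesWith : Set G → ℕ → Prop
  | P, 0 => Subgroup.closure P = ⊤
  | P, k + 1 => ∃ g, GeneratesWith (insert g P) k

/-- The subgroup generated by `P` and the Frattini subgroup. -/
def hull (P : Set G) : Subgroup G := Subgroup.closure P ⊔ frattini G

theorem closure_le_hull (P : Set G) : Subgroup.closure P ≤ hull P := le_sup_left

theorem subset_hull (P : Set G) : P ⊆ hull P :=
  Subgroup.subset_closure.trans (closure_le_hull P)

theorem hull_mono {P Q : Set G} (h : P ⊆ Q) : hull P ≤ hull Q :=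
  sup_le_sup_right (Subgroup.closure_mono h) _

theorem hull_insert (g : G) (P : Set G) :
    hull (insert g P) = Subgroup.closure {g} ⊔ hull P := by
  rw [hull, hull, Set.insert_eq, Subgroup.closure_union, sup_assoc]

theorem hull_insert_of_mem {g : G} {P : Set G} (hg : g ∈ hull P) :
    hull (insert g P) = hull P := by
  rw [hull_insert, sup_eq_right, Subgroup.closure_le]
  simpa using hg

theorem generatesWith_empty_one_iff : GeneratesWith (∅ : Set G) 1 ↔ IsCyclic G := by
  rw [isCyclic_iff_exists_zpowers_eq_top]
  simp [GeneratesWith, Subgroup.zpowers_eq_closure]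

theorem exists_mem_notMem_of_parity {K : Subgroup G} {P : Set G} (hP : P ⊆ K)
    (h : ¬ (Even P.ncard ↔ Even (Nat.card K))) : ∃ g ∈ K, g ∉ P := by
  by_contra! hc
  have : P = K := hP.antisymm hc
  exact h (by rw [this]; rfl)

theorem even_card_hull_of_le {P : Set G} (h : Even (Nat.card (hull P))) {Q : Set G}
    (hPQ : P ⊆ Q) : Even (Nat.card (hull Q)) :=
  (even_iff_two_dvd.1 h).trans (Subgroup.card_dvd_of_le (hull_mono hPQ)) |> even_iff_two_dvd.2

variable [Finite G]

/-- Frattini elements are nongenerators, so only the hull of a position matters for generation. -/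
theorem GeneratesWith.of_hull_le {k : ℕ} {P Q : Set G} (hPQ : hull P ≤ hull Q)
    (h : GeneratesWith P k) : GeneratesWith Q k := by
  induction k generalizing P Q with
  | zero =>
    have hP : Subgroup.closure P = ⊤ := h
    refine frattini_nongenerating (top_le_iff.1 (le_trans ?_ hPQ))
    rw [hull, hP]
    exact le_sup_left
  | succ k ih =>
    obtain ⟨g, hg⟩ := h
    refine ⟨g, ih ?_ hg⟩
    rw [hull_insert, hull_insert]
    exact sup_le_sup_left hPQ _

theorem GeneratesWith.mono {k : ℕ} {P Q : Set G} (hPQ : P ⊆ Q)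
    (h : GeneratesWith P k) : GeneratesWith Q k := h.of_hull_le (hull_mono hPQ)

theorem GeneratesWith.of_subset_closure {k : ℕ} {P Q : Set G} (hPQ : P ⊆ Subgroup.closure Q)
    (h : GeneratesWith P k) : GeneratesWith Q k :=
  h.of_hull_le (sup_le_sup_right ((Subgroup.closure_le _).2 hPQ) _)

theorem GeneratesWith.insert {k : ℕ} {P : Set G} (h : GeneratesWith P k) (g : G) :
    GeneratesWith (insert g P) k := h.mono (Set.subset_insert _ _)

theorem GeneratesWith.succ {k : ℕ} {P : Set G} (h : GeneratesWith P k) :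
    GeneratesWith P (k + 1) := ⟨1, h.insert 1⟩

theorem GeneratesWith.le {k l : ℕ} {P : Set G} (h : GeneratesWith P k) (hkl : k ≤ l) :
    GeneratesWith P l := by
  induction hkl with
  | refl => exact h
  | step _ ih => exact ih.succ

theorem generatesWith_insert_iff_of_mem {k : ℕ} {P : Set G} {g : G} (hg : g ∈ hull P) :
    GeneratesWith (insert g P) k ↔ GeneratesWith P k :=
  ⟨fun h => h.of_hull_le (hull_insert_of_mem hg).le, fun h => h.insert g⟩

theorem closure_insert_eq_top_iff_of_mem {P : Set G} {g : G} (hg : g ∈ hull P) :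
    Subgroup.closure (insert g P) = ⊤ ↔ Subgroup.closure P = ⊤ :=
  generatesWith_insert_iff_of_mem (k := 0) hg

theorem generatesWith_iff_exists_finset {k : ℕ} {P : Set G} :
    GeneratesWith P k ↔ ∃ S : Finset G, S.card ≤ k ∧ Subgroup.closure (P ∪ S) = ⊤ := by
  classical
  induction k generalizing P with
  | zero => simp [GeneratesWith]
  | succ k ih =>
    constructor
    · rintro ⟨g, hg⟩
      obtain ⟨S, hS, hc⟩ := ih.1 hg
      refine ⟨insert g S, (Finset.card_insert_le _ _).trans (by omega), ?_⟩
      rw [← hc]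
      congr 1
      ext x
      simp only [Finset.coe_insert, Set.mem_union, Set.mem_insert_iff]
      tauto
    · rintro ⟨S, hS, hc⟩
      rcases S.eq_empty_or_nonempty with rfl | ⟨g, hg⟩
      · exact (ih.2 ⟨∅, by simp, hc⟩).succ
      · refine ⟨g, ih.2 ⟨S.erase g, ?_, ?_⟩⟩
        · rw [Finset.card_erase_of_mem hg]; omega
        · rw [← hc]
          congr 1
          ext x
          by_cases hx : x = g <;> simp [hx, hg]

theorem generatesWith_empty_iff {k : ℕ} :
    GeneratesWith (∅ : Set G) k ↔ Group.rank G ≤ k := by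
  rw [generatesWith_iff_exists_finset]
  constructor
  · rintro ⟨S, hS, hc⟩
    rw [Set.empty_union] at hc
    exact (Group.rank_le hc).trans hS
  · intro h
    obtain ⟨S, hS, hc⟩ := Group.rank_spec G
    exact ⟨S, hS ▸ h, by rwa [Set.empty_union]⟩

/-- If all positions above `P` have hulls of the same parity, then the nim-number of `P` is
determined by the number of further elements needed to generate `G` and by the parity of `P`. -/
theorem nim_of_hull_parity (e : Prop) (P : Set G)
    (he : ∀ Q, P ⊆ Q → (Even (Nat.card (hull Q)) ↔ e)) (h0 : Subgroup.closure P ≠ ⊤) :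
    ((Even P.ncard ↔ e) → (GeneratesWith P 1 → nim P = 1) ∧ (¬ GeneratesWith P 1 → nim P = 0)) ∧
    (¬ (Even P.ncard ↔ e) →
      (GeneratesWith P 2 → nim P = 2) ∧ (¬ GeneratesWith P 2 → nim P = 1)) := by
  induction P using position_induction with
  | h P ih =>
    replace ih := fun g hg => ih g hg fun Q hQ => he Q ((Set.subset_insert _ _).trans hQ)
    have hpar : ∀ g ∉ P, ((Even (insert g P).ncard ↔ e) ↔ ¬ (Even P.ncard ↔ e)) := by
      intro g hg
      rw [even_ncard_insert hg]
      tauto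
    refine ⟨fun hp => ?_, fun hp => ?_⟩
    · have hodd := fun g hg hc => (ih g hg hc).2 (by rw [hpar g hg]; exact not_not.2 hp)
      refine ⟨fun h1 => ?_, fun h1 => ?_⟩
      · refine nim_eq_of h0 (fun m hm => ?_) (fun g hg => ?_)
        · obtain ⟨g, hg⟩ := h1
          have hgP : g ∉ P := fun h => h0 (by rwa [Set.insert_eq_of_mem h] at hg)
          exact ⟨g, hgP, by rw [nim_of_closure_eq_top hg]; omega⟩
        · by_cases hc : Subgroup.closure (insert g P) = ⊤
          · rw [nim_of_closure_eq_top hc]; omega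
          · rw [(hodd g hg hc).1 (h1.succ.insert g)]; omega
      · refine nim_eq_of h0 (fun m hm => by omega) (fun g hg => ?_)
        have hc : Subgroup.closure (insert g P) ≠ ⊤ := fun h => h1 ⟨g, h⟩
        by_cases h2 : GeneratesWith (insert g P) 2
        · rw [(hodd g hg hc).1 h2]; omega
        · rw [(hodd g hg hc).2 h2]; omega
    · have heven := fun g hg hc => (ih g hg hc).1 (by rw [hpar g hg]; exact hp)
      -- `P` and its hull differ in parity, so an element of the hull is still free. Selecting `s`
      -- flips the parity of the position and leaves the number of missing elements unchanged.
      obtain ⟨s, hs, hsP⟩ := exists_mem_notMem_of_parity (subset_hull P)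
        (by rwa [he P subset_rfl])
      have hsc : Subgroup.closure (insert s P) ≠ ⊤ := by
        rwa [Ne, closure_insert_eq_top_iff_of_mem hs]
      have hs1 := generatesWith_insert_iff_of_mem (k := 1) hs
      refine ⟨fun h2 => ?_, fun h2 => ?_⟩
      · refine nim_eq_of h0 (fun m hm => ?_) (fun g hg => ?_)
        · by_cases h1 : GeneratesWith P 1
          · interval_cases m
            · obtain ⟨g, hg⟩ := h1
              have hgP : g ∉ P := fun h => h0 (by rwa [Set.insert_eq_of_mem h] at hg)
              exact ⟨g, hgP, nim_of_closure_eq_top hg⟩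
            · exact ⟨s, hsP, (heven s hsP hsc).1 (hs1.2 h1)⟩
          · interval_cases m
            · exact ⟨s, hsP, (heven s hsP hsc).2 (mt hs1.1 h1)⟩
            · obtain ⟨g, hg⟩ := h2
              have hgP : g ∉ P := fun h => h1 (by rwa [Set.insert_eq_of_mem h] at hg)
              exact ⟨g, hgP, (heven g hgP fun hc => h1 ⟨g, hc⟩).1 hg⟩
        · by_cases hc : Subgroup.closure (insert g P) = ⊤
          · rw [nim_of_closure_eq_top hc]; omega
          · by_cases h1 : GeneratesWith (insert g P) 1
            · rw [(heven g hg hc).1 h1]; omega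
            · rw [(heven g hg hc).2 h1]; omega
      · have h1 : ¬ GeneratesWith P 1 := fun h => h2 h.succ
        refine nim_eq_of h0 (fun m hm => ⟨s, hsP, ?_⟩) (fun g hg => ?_)
        · rw [(heven s hsP hsc).2 (mt hs1.1 h1)]; omega
        · have hg1 : ¬ GeneratesWith (insert g P) 1 := fun h => h2 ⟨g, h⟩
          rw [(heven g hg fun hc => h1 ⟨g, hc⟩).2 hg1]; omega

theorem nim_of_even_hull {P : Set G} (hP : Even (Nat.card (hull P)))
    (h0 : Subgroup.closure P ≠ ⊤) :
    (Even P.ncard → (GeneratesWith P 1 → nim P = 1) ∧ (¬ GeneratesWith P 1 → nim P = 0)) ∧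
    (Odd P.ncard → (GeneratesWith P 2 → nim P = 2) ∧ (¬ GeneratesWith P 2 → nim P = 1)) := by
  have := nim_of_hull_parity True P (fun Q hQ => by simp [even_card_hull_of_le hP hQ]) h0
  simpa only [iff_true, Nat.not_even_iff_odd] using this

theorem nim_ne_zero_of_even_hull_of_odd {P : Set G} (hP : Even (Nat.card (hull P)))
    (h0 : Subgroup.closure P ≠ ⊤) (hodd : Odd P.ncard) : nim P ≠ 0 := by
  have := (nim_of_even_hull hP h0).2 hodd
  by_cases h2 : GeneratesWith P 2
  · rw [this.1 h2]; omega
  · rw [this.2 h2]; omega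

theorem nimGEN_of_odd_card (hG : Odd (Nat.card G)) (h0 : Group.rank G ≠ 0) :
    (Group.rank G ≤ 2 → nimGEN G = 2) ∧ (3 ≤ Group.rank G → nimGEN G = 1) := by
  have hcl : Subgroup.closure (∅ : Set G) ≠ ⊤ := fun h =>
    h0 (Nat.le_zero.1 (generatesWith_empty_iff.1 (show GeneratesWith ∅ 0 from h)))
  have h := (nim_of_hull_parity False (∅ : Set G) (fun Q _ => ?_) hcl).2 (by simp)
  · rw [generatesWith_empty_iff, not_le] at h
    exact h
  · rw [iff_false, Nat.not_even_iff_odd]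
    exact hG.of_dvd_nat (Subgroup.card_subgroup_dvd_card _)

/-- Every hull contains the Frattini subgroup, so all hulls are even. -/
theorem nimGEN_of_even_frattini (hG : Even (Nat.card (frattini G))) (h0 : Nontrivial G) :
    (Group.rank G ≤ 1 → nimGEN G = 1) ∧ (2 ≤ Group.rank G → nimGEN G = 0) := by
  have hcl : Subgroup.closure (∅ : Set G) ≠ ⊤ := by simp [bot_ne_top]
  have h := (nim_of_even_hull (P := ∅) (by simpa [hull] using hG) hcl).1 (by simp)
  rw [generatesWith_empty_iff, not_le] at h
  exact h

end Deficiency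

/-! ### Products of a 2-group and a group of odd order -/

section Product

theorem coprime_card_of_isPGroup_two {T H : Type*} [Group T] [Finite T] (hT : IsPGroup 2 T) (hH : Odd (Nat.card H)) :
    (Nat.card T).Coprime (Nat.card H) := by
  obtain ⟨n, hn⟩ := IsPGroup.iff_card.1 hT
  rw [hn]
  exact Nat.Coprime.pow_left n (Nat.coprime_two_left.2 hH)

variable {T H : Type*} [Group T] [Group H]

/-- A power of `x` with exponent 1 modulo `|T|` and 0 modulo `|H|` isolates the first component. -/
theorem mem_prod_of_coprime (hc : (Nat.card T).Coprime (Nat.card H)) {K : Subgroup (T × H)}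
    {x : T × H} (hx : x ∈ K) : (x.1, (1 : H)) ∈ K ∧ ((1 : T), x.2) ∈ K := by
  obtain ⟨m, hmT, hmH⟩ := Nat.chineseRemainder hc 1 0
  have h1 : (x.1, (1 : H)) = x ^ m := by
    refine Prod.ext ?_ ?_
    · have := pow_mod_natCard x.1 m
      rw [Prod.pow_fst, ← this, hmT, pow_mod_natCard, pow_one]
    · rw [Prod.pow_snd, ← pow_mod_natCard x.2 m, hmH, pow_mod_natCard, pow_zero]
  have h2 : (x.1, (1 : H)) ∈ K := h1 ▸ K.pow_mem hx m
  refine ⟨h2, ?_⟩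
  have h3 : ((1 : T), x.2) = (x.1, (1 : H))⁻¹ * x := by
    ext <;> simp
  exact h3 ▸ K.mul_mem (K.inv_mem h2) hx

theorem closure_eq_top_iff_of_coprime (hc : (Nat.card T).Coprime (Nat.card H))
    {P : Set (T × H)} : Subgroup.closure P = ⊤ ↔
      Subgroup.closure (Prod.fst '' P) = ⊤ ∧ Subgroup.closure (Prod.snd '' P) = ⊤ := by
  have hT : Subgroup.closure (Prod.fst '' P) = (Subgroup.closure P).map (MonoidHom.fst T H) :=
    (MonoidHom.map_closure (MonoidHom.fst T H) P).symm
  have hH : Subgroup.closure (Prod.snd '' P) = (Subgroup.closure P).map (MonoidHom.snd T H) :=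
    (MonoidHom.map_closure (MonoidHom.snd T H) P).symm
  rw [hT, hH]
  constructor
  · intro h
    rw [h]
    exact ⟨Subgroup.map_top_of_surjective _ Prod.fst_surjective,
      Subgroup.map_top_of_surjective _ Prod.snd_surjective⟩
  · rintro ⟨h1, h2⟩
    refine (Subgroup.eq_top_iff' _).2 fun ⟨t, h⟩ => ?_
    obtain ⟨x, hx, rfl⟩ := (Subgroup.eq_top_iff' _).1 h1 t
    obtain ⟨y, hy, rfl⟩ := (Subgroup.eq_top_iff' _).1 h2 h
    simpa using mul_mem (mem_prod_of_coprime hc hx).1 (mem_prod_of_coprime hc hy).2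

theorem generatesWith_iff_of_coprime (hc : (Nat.card T).Coprime (Nat.card H))
    {P : Set (T × H)} {k : ℕ} : GeneratesWith P k ↔
      GeneratesWith (Prod.fst '' P) k ∧ GeneratesWith (Prod.snd '' P) k := by
  induction k generalizing P with
  | zero => exact closure_eq_top_iff_of_coprime hc
  | succ k ih =>
    constructor
    · rintro ⟨g, hg⟩
      rw [ih, Set.image_insert_eq, Set.image_insert_eq] at hg
      exact ⟨⟨g.1, hg.1⟩, ⟨g.2, hg.2⟩⟩
    · rintro ⟨⟨t, ht⟩, ⟨h, hh⟩⟩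
      refine ⟨(t, h), ?_⟩
      rw [ih, Set.image_insert_eq, Set.image_insert_eq]
      exact ⟨ht, hh⟩

theorem even_card_hull_of_mem [Finite T] (hT : IsPGroup 2 T) (hH : Odd (Nat.card H)) {P : Set (T × H)}
    {x : T × H} (hx : x ∈ P) (hx1 : x.1 ≠ 1) : Even (Nat.card (hull P)) := by
  have hmem : (x.1, (1 : H)) ∈ hull P :=
    (mem_prod_of_coprime (coprime_card_of_isPGroup_two hT hH) (subset_hull P hx)).1
  have h2 : 2 ∣ orderOf (x.1, (1 : H)) := by
    rw [Prod.orderOf_mk, orderOf_one, Nat.lcm_one_right]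
    exact hT.dvd_orderOf hx1
  exact even_iff_two_dvd.2 (h2.trans (Subgroup.orderOf_dvd_natCard _ hmem))

/-- A position of even size inside the odd factor can be extended inside the subgroup that it
generates. -/
theorem exists_mem_closure_notMem (hH : Odd (Nat.card H)) {P : Set (T × H)}
    (hP : ∀ x ∈ P, x.1 = 1) (hev : Even P.ncard) : ∃ g ∈ Subgroup.closure P, g ∉ P ∧ g.1 = 1 := by
  have hle : Subgroup.closure P ≤ (MonoidHom.fst T H).ker := by
    rw [Subgroup.closure_le]
    exact fun x hx => hP x hx
  have hinj : Function.Injective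
      ((MonoidHom.snd T H).comp (Subgroup.closure P).subtype) := by
    rintro ⟨x, hx⟩ ⟨y, hy⟩ h
    have hx1 : x.1 = 1 := hle hx
    have hy1 : y.1 = 1 := hle hy
    exact Subtype.ext (Prod.ext (hx1.trans hy1.symm) h)
  have hodd : Odd (Nat.card (Subgroup.closure P)) :=
    hH.of_dvd_nat (Subgroup.card_dvd_of_injective _ hinj)
  obtain ⟨g, hg, hgP⟩ := exists_mem_notMem_of_parity (K := Subgroup.closure P)
    Subgroup.subset_closure (fun h => (Nat.not_even_iff_odd.2 hodd) (h.1 hev))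
  exact ⟨g, hg, hgP, hle hg⟩

variable [Finite T] [Finite H]

/-- Each first move `g` has a winning reply. If `g.1 ≠ 1`, the position is odd with even hull, hence
nonzero. If `g.1 = 1`, either one element finishes the game, or the reply `(t, 1)` gives an even
position with even hull that one element still cannot complete, which has value 0. -/
theorem nimGEN_prod_eq_zero (hT : IsPGroup 2 T) (hH : Odd (Nat.card H))
    (h1 : ¬ GeneratesWith (∅ : Set (T × H)) 1) {t : T} (ht : t ≠ 1)
    (h : ∀ h : H, GeneratesWith {(t, 1), ((1 : T), h)} 1 →
      GeneratesWith {((1 : T), h)} 1) : nimGEN (T × H) = 0 := by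
  refine nim_eq_of (fun h0 => h1 (GeneratesWith.succ h0)) (fun m hm => absurd hm (by omega))
    fun g _ => ?_
  rw [insert_empty_eq]
  have hg0 : Subgroup.closure {g} ≠ ⊤ := fun h0 => h1 ⟨g, by rwa [insert_empty_eq]⟩
  by_cases hg : g.1 = 1
  · obtain ⟨g1, g2⟩ := g
    obtain rfl : g1 = 1 := hg
    by_cases hg1 : GeneratesWith {((1 : T), g2)} 1
    · obtain ⟨x, hx⟩ := hg1
      have hxP : x ∉ ({((1 : T), g2)} : Set (T × H)) := fun h' =>
        hg0 (by rwa [Set.insert_eq_of_mem h'] at hx)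
      have := nim_insert_ne hg0 hxP
      rw [nim_of_closure_eq_top hx] at this
      exact this.symm
    · have hn1 := mt (h g2) hg1
      have htP : (t, (1 : H)) ∉ ({((1 : T), g2)} : Set (T × H)) := by
        intro h'
        exact ht (congrArg Prod.fst (Set.mem_singleton_iff.1 h'))
      have := nim_insert_ne hg0 htP
      have hev : Even (insert (t, (1 : H)) {((1 : T), g2)} : Set (T × H)).ncard := by
        rw [even_ncard_insert htP, Set.ncard_singleton]
        decide
      rw [((nim_of_even_hull (even_card_hull_of_mem hT hH (Set.mem_insert _ _) ht)
        (fun h0 => hn1 (GeneratesWith.succ h0))).1 hev).2 hn1] at this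
      exact this.symm
  · exact nim_ne_zero_of_even_hull_of_odd
      (even_card_hull_of_mem hT hH (Set.mem_singleton g) hg) hg0 (by simp)

theorem nimGEN_prod_eq_zero_of_three_le_rank [Nontrivial T] (hT : IsPGroup 2 T)
    (hH : Odd (Nat.card H)) (h : 3 ≤ Group.rank (T × H)) : nimGEN (T × H) = 0 := by
  obtain ⟨t, ht⟩ := exists_ne (1 : T)
  -- The premise `hgen` cannot hold: `(t, 1)` and `(1, h')` both lie in the cyclic group generated
  -- by `(t, h')`, so two elements would generate.
  refine nimGEN_prod_eq_zero hT hH (by rw [generatesWith_empty_iff]; omega) ht fun h' hgen => ?_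
  have h2 : GeneratesWith (∅ : Set (T × H)) 2 := by
    refine ⟨(t, h'), hgen.of_subset_closure ?_⟩
    have := mem_prod_of_coprime (coprime_card_of_isPGroup_two hT hH)
      (Subgroup.subset_closure (Set.mem_insert (t, h') ∅))
    rintro x (rfl | rfl)
    exacts [this.1, this.2]
  rw [generatesWith_empty_iff] at h2
  omega

/-! ### The 2-part has order two -/

section CardTwo

theorem closure_eq_top_iff_of_card_two (hT : Nat.card T = 2) {S : Set T} :
    Subgroup.closure S = ⊤ ↔ ∃ t ∈ S, t ≠ 1 := by
  have : Fact (Nat.card T).Prime := ⟨hT ▸ Nat.prime_two⟩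
  have hnt : Nontrivial T := Finite.one_lt_card_iff_nontrivial.1 (by omega)
  constructor
  · intro h
    by_contra! hc
    rw [Subgroup.closure_eq_bot_iff.2 fun t ht => hc t ht] at h
    exact bot_ne_top h
  · rintro ⟨t, ht, ht1⟩
    refine ((Subgroup.closure S).eq_bot_or_eq_top_of_prime_card).resolve_left fun h => ht1 ?_
    exact Subgroup.closure_eq_bot_iff.1 h ht

theorem generatesWith_one_of_card_two (hT : Nat.card T = 2) (S : Set T) : GeneratesWith S 1 := by
  have hnt : Nontrivial T := Finite.one_lt_card_iff_nontrivial.1 (by omega)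
  obtain ⟨t, ht⟩ := exists_ne (1 : T)
  exact ⟨t, (closure_eq_top_iff_of_card_two hT).2 ⟨t, Set.mem_insert _ _, ht⟩⟩

theorem nimGEN_prod_eq_zero_of_card_two (hT : Nat.card T = 2) (hH : Odd (Nat.card H))
    (h : ¬ IsCyclic H) : nimGEN (T × H) = 0 := by
  have hT2 : IsPGroup 2 T := IsPGroup.of_card (n := 1) (by simpa using hT)
  have hc := coprime_card_of_isPGroup_two hT2 hH
  have hnt : Nontrivial T := Finite.one_lt_card_iff_nontrivial.1 (by omega)
  obtain ⟨t, ht⟩ := exists_ne (1 : T)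
  refine nimGEN_prod_eq_zero hT2 hH (fun h1 => h ?_) ht fun h' hgen => ?_
  · rw [generatesWith_iff_of_coprime hc, Set.image_empty, Set.image_empty] at h1
    exact generatesWith_empty_one_iff.1 h1.2
  · rw [generatesWith_iff_of_coprime hc] at hgen ⊢
    refine ⟨generatesWith_one_of_card_two hT _, hgen.2.of_subset_closure ?_⟩
    rw [Set.image_pair, Set.image_singleton]
    rintro x (rfl | rfl)
    exacts [one_mem _, Subgroup.subset_closure rfl]

/-- One element always completes a generating set, so a move out of `1 × H` has value 0 if it
finishes the game, and otherwise 1 or 2 by parity. Backward induction inside `1 × H` gives the four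
values. -/
theorem nim_of_card_two_of_isCyclic (hT : Nat.card T = 2) (hH : Odd (Nat.card H))
    [IsCyclic H] (P : Set (T × H)) (hP : ∀ x ∈ P, x.1 = 1) :
    (Subgroup.closure (Prod.snd '' P) = ⊤ →
      (Odd P.ncard → nim P = 1) ∧ (Even P.ncard → nim P = 2)) ∧
    (Subgroup.closure (Prod.snd '' P) ≠ ⊤ →
      (Odd P.ncard → nim P = 3) ∧ (Even P.ncard → nim P = 4)) := by
  classical
  have hT2 : IsPGroup 2 T := IsPGroup.of_card (n := 1) (by simpa using hT)
  have hc := coprime_card_of_isPGroup_two hT2 hH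
  have hnt : Nontrivial T := Finite.one_lt_card_iff_nontrivial.1 (by omega)
  have hgen1 : ∀ Q : Set (T × H), GeneratesWith Q 1 := fun Q =>
    (generatesWith_iff_of_coprime hc).2 ⟨generatesWith_one_of_card_two hT _,
      (generatesWith_empty_one_iff.2 ‹_›).mono (Set.empty_subset _)⟩
  obtain ⟨t, ht⟩ := exists_ne (1 : T)
  obtain ⟨u, hu⟩ : ∃ u : H, Subgroup.closure {u} = ⊤ := by
    simpa [GeneratesWith] using generatesWith_empty_one_iff.2 ‹IsCyclic H›
  induction P using position_induction with
  | h P ih =>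
    have hcl : Subgroup.closure P ≠ ⊤ := by
      intro h
      obtain ⟨_, ⟨x, hx, rfl⟩, hx1⟩ :=
        (closure_eq_top_iff_of_card_two hT).1 ((closure_eq_top_iff_of_coprime hc).1 h).1
      exact hx1 (hP x hx)
    have hnotMem : ∀ g : T × H, g.1 ≠ 1 → g ∉ P := fun g hg h => hg (hP g h)
    have hval : ∀ g ∉ P, nim (insert g P) =
        if g.1 = 1 then
          if Subgroup.closure (insert g.2 (Prod.snd '' P)) = ⊤ then
            if Even P.ncard then 1 else 2
          else if Even P.ncard then 3 else 4
        else if Subgroup.closure (insert g.2 (Prod.snd '' P)) = ⊤ then 0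
        else if Even P.ncard then 2 else 1 := by
      intro g hgP
      by_cases hg : g.1 = 1
      · have := ih g hgP (by rintro x (rfl | hx); exacts [hg, hP x hx])
        rw [Set.image_insert_eq, ← Nat.not_even_iff_odd, even_ncard_insert hgP] at this
        rw [if_pos hg]
        split_ifs with h1 h2 h2
        · exact (this.1 h1).1 (not_not.2 h2)
        · exact (this.1 h1).2 h2
        · exact (this.2 h1).1 (not_not.2 h2)
        · exact (this.2 h1).2 h2
      · have htop : Subgroup.closure (insert g P) = ⊤ ↔
            Subgroup.closure (insert g.2 (Prod.snd '' P)) = ⊤ := by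
          rw [closure_eq_top_iff_of_coprime hc, closure_eq_top_iff_of_card_two hT,
            ← Set.image_insert_eq]
          exact and_iff_right ⟨g.1, ⟨g, Set.mem_insert _ _, rfl⟩, hg⟩
        rw [if_neg hg, ← htop]
        split_ifs with h1 h2
        · exact nim_of_closure_eq_top h1
        all_goals
          have := nim_of_even_hull (even_card_hull_of_mem hT2 hH (Set.mem_insert g P) hg) h1
          rw [← Nat.not_even_iff_odd, even_ncard_insert hgP] at this
        · exact (this.2 (not_not.2 h2)).1 (hgen1 _).succ
        · exact (this.1 h2).1 (hgen1 _)
    -- The subgroup generated by `P` has odd order, so an even `P` does not exhaust it.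
    have hstay : Even P.ncard → ∃ g ∉ P, g.1 = 1 ∧
        (Subgroup.closure (insert g.2 (Prod.snd '' P)) = ⊤ ↔
          Subgroup.closure (Prod.snd '' P) = ⊤) := by
      intro hp
      obtain ⟨g, hg, hgP, hg1⟩ := exists_mem_closure_notMem hH hP hp
      refine ⟨g, hgP, hg1, closure_insert_eq_top_iff_of_mem (closure_le_hull _ ?_)⟩
      have : (MonoidHom.snd T H) g ∈ (Subgroup.closure P).map (MonoidHom.snd T H) :=
        Subgroup.mem_map_of_mem _ hg
      rwa [MonoidHom.map_closure] at this
    have hone : Subgroup.closure (insert 1 (Prod.snd '' P)) = ⊤ ↔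
        Subgroup.closure (Prod.snd '' P) = ⊤ :=
      closure_insert_eq_top_iff_of_mem (one_mem _)
    have hutop : Subgroup.closure (insert u (Prod.snd '' P)) = ⊤ :=
      top_le_iff.1 (hu ▸ Subgroup.closure_mono (Set.singleton_subset_iff.2 (Set.mem_insert _ _)))
    refine ⟨fun hS => ?_, fun hS => ?_⟩
    · have htop : ∀ h : H, Subgroup.closure (insert h (Prod.snd '' P)) = ⊤ := fun h =>
        top_le_iff.1 (hS ▸ Subgroup.closure_mono (Set.subset_insert _ _))
      simp only [htop, if_true] at hval
      have ht0 : nim (insert (t, 1) P) = 0 := by rw [hval _ (hnotMem _ ht), if_neg ht]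
      refine ⟨fun hp => ?_, fun hp => ?_⟩
      · rw [← Nat.not_even_iff_odd] at hp
        simp only [hp, if_false] at hval
        refine nim_eq_of hcl (fun m hm => ⟨_, hnotMem (t, 1) ht, by omega⟩) fun g hg => ?_
        rw [hval g hg]
        split_ifs <;> omega
      · simp only [hp, if_true] at hval
        refine nim_eq_of hcl (fun m hm => ?_) fun g hg => ?_
        · interval_cases m
          · exact ⟨_, hnotMem (t, 1) ht, ht0⟩
          · obtain ⟨s, hsP, hs1, -⟩ := hstay hp
            exact ⟨s, hsP, by rw [hval s hsP, if_pos hs1]⟩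
        · rw [hval g hg]
          split_ifs <;> omega
    · have huP : ((1 : T), u) ∉ P := fun h => hS (by
        rwa [Set.insert_eq_of_mem (show u ∈ Prod.snd '' P from ⟨_, h, rfl⟩)] at hutop)
      have ht0 : nim (insert (t, u) P) = 0 := by
        rw [hval _ (hnotMem _ ht), if_neg ht, if_pos hutop]
      have ht1 := hval _ (hnotMem (t, 1) ht)
      rw [if_neg ht, if_neg (mt hone.1 hS)] at ht1
      have hu1 := hval _ huP
      rw [if_pos rfl, if_pos hutop] at hu1
      refine ⟨fun hp => ?_, fun hp => ?_⟩
      · rw [← Nat.not_even_iff_odd] at hp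
        simp only [hp, if_false] at hval ht1 hu1
        refine nim_eq_of hcl (fun m hm => ?_) fun g hg => ?_
        · interval_cases m
          -- Finish at once, supply only the `T`-part, or supply only a generator of `H`.
          exacts [⟨_, hnotMem (t, u) ht, ht0⟩, ⟨_, hnotMem (t, 1) ht, ht1⟩, ⟨_, huP, hu1⟩]
        · rw [hval g hg]
          split_ifs <;> omega
      · simp only [hp, if_true] at hval ht1 hu1
        refine nim_eq_of hcl (fun m hm => ?_) fun g hg => ?_
        · interval_cases m
          · exact ⟨_, hnotMem (t, u) ht, ht0⟩
          · exact ⟨_, huP, hu1⟩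
          · exact ⟨_, hnotMem (t, 1) ht, ht1⟩
          · obtain ⟨s, hsP, hs1, hs⟩ := hstay hp
            exact ⟨s, hsP, by rw [hval s hsP, if_pos hs1, if_neg (mt hs.1 hS)]⟩
        · rw [hval g hg]
          split_ifs <;> omega

theorem nimGEN_prod_of_card_two_of_isCyclic (hT : Nat.card T = 2) (hH : Odd (Nat.card H))
    [IsCyclic H] : nimGEN (T × H) = if Nat.card H = 1 then 2 else 4 := by
  have := nim_of_card_two_of_isCyclic hT hH ∅ (by simp)
  rw [Set.image_empty, Subgroup.closure_empty, Set.ncard_empty] at this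
  split_ifs with h
  · exact (this.1 (Subgroup.card_eq_one.1 (by rwa [Subgroup.card_top])).symm).2 (by simp)
  · exact (this.2 fun hb => h (by rw [← Subgroup.card_top, ← hb, Subgroup.card_bot])).2 (by simp)

end CardTwo

/-! ### The 2-part is a Klein four-group -/

section KleinFour

open scoped IsKleinFour

theorem not_closure_singleton_of_isKleinFour {T : Type*} [Group T] [IsKleinFour T] (t : T) :
    Subgroup.closure {t} ≠ ⊤ := fun h =>
  IsKleinFour.not_isCyclic (G := T)
    (generatesWith_empty_one_iff.1 ⟨t, by rwa [insert_empty_eq]⟩)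

theorem generatesWith_one_of_isKleinFour {T : Type*} [Group T] [IsKleinFour T] {S : Set T} {t : T}
    (ht : t ∈ S) (ht1 : t ≠ 1) : GeneratesWith S 1 := by
  obtain ⟨s, hs⟩ : ∃ s, s ∉ Subgroup.closure {t} := by
    by_contra! h
    exact not_closure_singleton_of_isKleinFour t ((Subgroup.eq_top_iff' _).2 h)
  have hs1 : s ≠ 1 := fun h => hs (h ▸ one_mem _)
  have hst : s ≠ t := fun h => hs (h ▸ Subgroup.subset_closure rfl)
  refine ⟨s, (Subgroup.eq_top_iff' _).2 fun z => ?_⟩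
  have hsm : s ∈ Subgroup.closure (insert s S) := Subgroup.subset_closure (Set.mem_insert _ _)
  have htm : t ∈ Subgroup.closure (insert s S) :=
    Subgroup.subset_closure (Set.mem_insert_of_mem _ ht)
  by_cases hz1 : z = 1
  · exact hz1 ▸ one_mem _
  by_cases hzs : z = s
  · exact hzs ▸ hsm
  by_cases hzt : z = t
  · exact hzt ▸ htm
  rw [IsKleinFour.eq_mul_of_ne_all hs1 ht1 hst hz1 hzs hzt]
  exact mul_mem hsm htm

theorem isPGroup_of_isKleinFour {T : Type*} [Group T] [IsKleinFour T] : IsPGroup 2 T :=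
  IsPGroup.of_card (n := 2) (by rw [IsKleinFour.card_four]; rfl)

theorem closure_insert_ne_top_of_isKleinFour {T H : Type*} [Group T] [Group H]
    [IsKleinFour T] {P : Set (T × H)}
    (hP : ∀ x ∈ P, x.1 = 1) (g : T × H) : Subgroup.closure (insert g P) ≠ ⊤ := by
  intro h
  have h1 : Subgroup.closure (Prod.fst '' insert g P) = ⊤ := by
    have : Subgroup.closure (Prod.fst '' insert g P) =
        (Subgroup.closure (insert g P)).map (MonoidHom.fst T H) :=
      (MonoidHom.map_closure (MonoidHom.fst T H) _).symm
    rw [this, h, Subgroup.map_top_of_surjective _ Prod.fst_surjective]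
  refine not_closure_singleton_of_isKleinFour g.1 (top_le_iff.1 (h1 ▸ ?_))
  rw [Subgroup.closure_le]
  rintro _ ⟨x, rfl | hx, rfl⟩
  · exact Subgroup.subset_closure rfl
  · rw [hP x hx]
    exact one_mem _

theorem generatesWith_insert_of_isKleinFour {T H : Type*} [Group T] [Group H]
    [IsKleinFour T] (hH : Odd (Nat.card H))
    {P : Set (T × H)} {g : T × H} (hg : g.1 ≠ 1) {k : ℕ} (hk : 1 ≤ k)
    (h : GeneratesWith (insert g.2 (Prod.snd '' P)) k) : GeneratesWith (insert g P) k := by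
  rw [generatesWith_iff_of_coprime (coprime_card_of_isPGroup_two isPGroup_of_isKleinFour hH)]
  refine ⟨(generatesWith_one_of_isKleinFour (Set.mem_image_of_mem _ (Set.mem_insert g P)) hg).le hk, ?_⟩
  rwa [Set.image_insert_eq]

/-- From an odd position, leaving `1 × H` gives value 1 and staying gives an even position. From an
even one, a free element of the odd-order subgroup generated by `P` leads to an odd position. -/
theorem nim_eq_zero_iff_of_isKleinFour [IsKleinFour T] (hH : Odd (Nat.card H))
    (P : Set (T × H)) (hP : ∀ x ∈ P, x.1 = 1) (hgen : GeneratesWith (Prod.snd '' P) 1) :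
    nim P = 0 ↔ Odd P.ncard := by
  induction P using position_induction with
  | h P ih =>
    have hcl : Subgroup.closure P ≠ ⊤ := fun h =>
      closure_insert_ne_top_of_isKleinFour hP 1
        (top_le_iff.1 (h ▸ Subgroup.closure_mono (Set.subset_insert _ _)))
    have hin : ∀ g ∉ P, g.1 = 1 → (nim (insert g P) = 0 ↔ ¬ Odd P.ncard) := by
      intro g hg hg1
      rw [ih g hg (by rintro x (rfl | hx); exacts [hg1, hP x hx])
        (by rw [Set.image_insert_eq]; exact hgen.insert _), ← Nat.not_even_iff_odd,
        even_ncard_insert hg, ← Nat.not_even_iff_odd]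
    by_cases hodd : Odd P.ncard
    · refine iff_of_true (nim_eq_of hcl (fun m hm => absurd hm (by omega)) fun g hg => ?_) hodd
      by_cases hg1 : g.1 = 1
      · rw [Ne, hin g hg hg1]
        exact not_not.2 hodd
      · rw [((nim_of_even_hull (even_card_hull_of_mem isPGroup_of_isKleinFour hH
          (Set.mem_insert _ _) hg1) (closure_insert_ne_top_of_isKleinFour hP g)).1
          (by rwa [even_ncard_insert hg, Nat.not_even_iff_odd])).1
          (generatesWith_insert_of_isKleinFour hH hg1 le_rfl (hgen.insert _))]
        omega
    · refine iff_of_false (fun h => ?_) hodd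
      obtain ⟨g, -, hg, hg1⟩ := exists_mem_closure_notMem hH hP (Nat.not_odd_iff_even.1 hodd)
      exact nim_insert_ne hcl hg (((hin g hg hg1).2 hodd).trans h.symm)

/-- Selecting `(1, x)`, where `x` belongs to a generating set of `H` of size at most 2, reaches
value 0. No first move reaches 1: outside `1 × H` the value is 2, and inside it is 0 or there is an
option of value 1. -/
theorem nimGEN_prod_of_isKleinFour [IsKleinFour T] (hH : Odd (Nat.card H))
    (h : Group.rank H ≤ 2) : nimGEN (T × H) = 1 := by
  have hgen : ∀ S : Set H, GeneratesWith S 2 := fun S =>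
    (generatesWith_empty_iff.2 h).mono (Set.empty_subset S)
  have hcl : ∀ g : T × H, Subgroup.closure {g} ≠ ⊤ := fun g => by
    simpa using closure_insert_ne_top_of_isKleinFour (P := ∅) (by simp) g
  have hzero : ∀ h : H, GeneratesWith {h} 1 → nim {((1 : T), h)} = 0 := fun h hh =>
    (nim_eq_zero_iff_of_isKleinFour hH {((1 : T), h)} (by simp)
      (by rwa [Set.image_singleton])).2 (by simp)
  have hev : ∀ (g : T × H) (P : Set (T × H)), g.1 ≠ 1 → Even (Nat.card (hull (insert g P))) :=
    fun g P hg => even_card_hull_of_mem isPGroup_of_isKleinFour hH (Set.mem_insert _ _) hg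
  refine nim_eq_of (fun h0 => hcl 1 (top_le_iff.1 (h0 ▸ Subgroup.closure_mono
    (Set.empty_subset _)))) (fun m hm => ?_) (fun g _ => ?_)
  · obtain ⟨x, hx⟩ := hgen ∅
    refine ⟨(1, x), Set.notMem_empty _, ?_⟩
    rw [insert_empty_eq] at hx ⊢
    rw [hzero x hx]
    omega
  · by_cases hg1 : g.1 = 1
    · obtain ⟨g1, g2⟩ := g
      obtain rfl : g1 = 1 := hg1
      rw [insert_empty_eq]
      by_cases h1 : GeneratesWith {g2} 1
      · rw [hzero g2 h1]
        omega
      · obtain ⟨x, hx⟩ := hgen {g2}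
        have hnt : Nontrivial T := Finite.one_lt_card_iff_nontrivial.1 (by
          rw [IsKleinFour.card_four]; omega)
        obtain ⟨t, ht⟩ := exists_ne (1 : T)
        have hxP : (t, x) ∉ ({((1 : T), g2)} : Set (T × H)) := fun h' =>
          ht (congrArg Prod.fst (Set.mem_singleton_iff.1 h'))
        have hne := nim_insert_ne (hcl (1, g2)) hxP
        rw [((nim_of_even_hull (hev (t, x) {((1 : T), g2)} ht)
          (closure_insert_ne_top_of_isKleinFour (by simp) (t, x))).1
          (by rw [even_ncard_insert hxP, Set.ncard_singleton]; decide)).1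
          (generatesWith_insert_of_isKleinFour hH ht le_rfl
            (by rwa [Set.image_singleton]))] at hne
        exact hne.symm
    · rw [((nim_of_even_hull (hev g ∅ hg1)
        (closure_insert_ne_top_of_isKleinFour (by simp) g)).2 (by simp)).1
        (generatesWith_insert_of_isKleinFour hH hg1 one_le_two (hgen _))]
      omega

end KleinFour

/-! ### Squares in the Frattini subgroup -/

section Frattini

/-- A maximal subgroup either projects onto `T`, and then contains `T × 1` by coprimality, or is the
preimage of an index-2 subgroup of `T`, which contains all squares. So `(t * t, 1)`, of even order,
is a Frattini element. -/
theorem even_card_frattini_prod {T H : Type*} [Group T] [Group H] [Finite T] (hT : IsPGroup 2 T) (hH : Odd (Nat.card H)) {t : T}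
    (ht : t * t ≠ 1) : Even (Nat.card (frattini (T × H))) := by
  have hc := coprime_card_of_isPGroup_two hT hH
  have hmem : (t * t, (1 : H)) ∈ frattini (T × H) := by
    simp only [frattini, Order.radical, Subgroup.mem_iInf]
    intro M hM
    by_cases hMT : M.map (MonoidHom.fst T H) = ⊤
    · obtain ⟨x, hx, hxt⟩ := (Subgroup.eq_top_iff' _).1 hMT (t * t)
      rw [← hxt]
      exact (mem_prod_of_coprime hc hx).1
    · obtain ⟨n, hn⟩ := IsPGroup.iff_card.1 hT
      obtain ⟨m, hm⟩ := IsPGroup.iff_card.1 (hT.to_subgroup (M.map (MonoidHom.fst T H)))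
      have hmn : m < n := by
        rw [← Nat.pow_lt_pow_iff_right one_lt_two, ← hm, ← hn]
        refine lt_of_le_of_ne (Subgroup.card_le_card_group _) fun h => hMT ?_
        exact Subgroup.eq_top_of_card_eq _ h
      obtain ⟨K, hK, hMK⟩ := Sylow.exists_subgroup_card_pow_prime_le 2 (m := n - 1)
        (hn ▸ pow_dvd_pow 2 (Nat.sub_le n 1)) _ hm (by omega)
      have hindex : K.index = 2 := by
        have := K.card_mul_index
        rw [hK, hn, ← pow_sub_one_mul (by omega : n ≠ 0)] at this
        exact Nat.eq_of_mul_eq_mul_left (by positivity) this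
      have hKtop : K.comap (MonoidHom.fst T H) ≠ ⊤ := by
        intro h
        have hK1 : K = ⊤ := by
          rw [← Subgroup.map_comap_eq_self_of_surjective
            (f := MonoidHom.fst T H) Prod.fst_surjective K, h,
            Subgroup.map_top_of_surjective _ Prod.fst_surjective]
        rw [hK1, Subgroup.index_top] at hindex
        omega
      have hMeq : K.comap (MonoidHom.fst T H) = M :=
        (hM.le_iff.1 (Subgroup.map_le_iff_le_comap.1 hMK)).resolve_left hKtop
      rw [← hMeq]
      exact Subgroup.mul_self_mem_of_index_two hindex t
  have h2 : 2 ∣ orderOf (t * t, (1 : H)) := by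
    rw [Prod.orderOf_mk, orderOf_one, Nat.lcm_one_right]
    exact hT.dvd_orderOf ht
  exact even_iff_two_dvd.2 (h2.trans (Subgroup.orderOf_dvd_natCard _ hmem))

end Frattini

end Product

/-! ### Splitting a nilpotent group into its 2-part and odd part -/

theorem isPGroup_pi {p : ℕ} [Fact p.Prime] {ι : Type*} [Finite ι] {F : ι → Type*}
    [∀ i, Group (F i)] [∀ i, Finite (F i)] (h : ∀ i, IsPGroup p (F i)) :
    IsPGroup p (∀ i, F i) := by
  have := Fintype.ofFinite ι
  choose n hn using fun i => IsPGroup.iff_card.1 (h i)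
  refine IsPGroup.of_card (n := ∑ i, n i) ?_
  rw [Nat.card_pi, Finset.prod_congr rfl fun i _ => hn i, Finset.prod_pow_eq_pow_sum]

theorem odd_card_pi {ι : Type*} [Finite ι] {F : ι → Type*} (h : ∀ i, Odd (Nat.card (F i))) :
    Odd (Nat.card (∀ i, F i)) := by
  have := Fintype.ofFinite ι
  rw [Nat.card_pi, ← Nat.coprime_two_left]
  exact Nat.Coprime.prod_right fun i _ => Nat.coprime_two_left.2 (h i)

theorem exists_mulEquiv_prod_of_isNilpotent (G : Type*) [Group G] [Finite G]
    [Group.IsNilpotent G] :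
    ∃ T H : Subgroup G, IsPGroup 2 T ∧ Odd (Nat.card H) ∧ Nonempty (G ≃* T × H) := by
  classical
  -- A finite nilpotent group is the product of its Sylow subgroups; the factors are then sorted by
  -- whether the prime is 2.
  obtain ⟨e⟩ := ((Group.isNilpotent_of_finite_tfae (G := G)).out 0 4).1 ‹_›
  let F : (Nat.card G).primeFactors → Type _ := fun p => ∀ P : Sylow p G, (P : Subgroup G)
  let q : (Nat.card G).primeFactors → Prop := fun p => (p : ℕ) = 2
  let split : (∀ p, F p) ≃* (∀ p : {p // q p}, F p) × (∀ p : {p // ¬ q p}, F p) :=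
    { Equiv.piEquivPiSubtypeProd q F with map_mul' := fun _ _ => rfl }
  have hT : IsPGroup 2 (∀ p : {p // q p}, F p) :=
    isPGroup_pi fun p => isPGroup_pi fun P => by
      have h2 : ((p : (Nat.card G).primeFactors) : ℕ) = 2 := p.2
      exact P.isPGroup'.mono h2.dvd
  have hH : Odd (Nat.card (∀ p : {p // ¬ q p}, F p)) :=
    odd_card_pi fun p => odd_card_pi fun P => by
      have hp := Nat.prime_of_mem_primeFactors p.1.2
      have : Fact ((p : (Nat.card G).primeFactors) : ℕ).Prime := ⟨hp⟩
      obtain ⟨n, hn⟩ := IsPGroup.iff_card.1 P.isPGroup'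
      have : Odd (((p : (Nat.card G).primeFactors) : ℕ) ^ n) := (hp.odd_of_ne_two p.2).pow
      rwa [← hn] at this
  let f := e.symm.trans split
  let iT := f.symm.toMonoidHom.comp (MonoidHom.inl _ _)
  let iH := f.symm.toMonoidHom.comp (MonoidHom.inr _ _)
  have hiT : Function.Injective iT :=
    f.symm.injective.comp fun _ _ h => (Prod.ext_iff.1 h).1
  have hiH : Function.Injective iH :=
    f.symm.injective.comp fun _ _ h => (Prod.ext_iff.1 h).2
  have eT := MonoidHom.ofInjective hiT
  have eH := MonoidHom.ofInjective hiH
  refine ⟨iT.range, iH.range, hT.of_equiv eT, ?_, ⟨f.trans (eT.prodCongr eH)⟩⟩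
  rwa [← Nat.card_congr eH.toEquiv]

/-! ### Matching the cases with the groups in the formula -/

theorem card_Z (n : ℕ) : Nat.card (Z n) = n := Nat.card_zmod n

theorem nonempty_mulEquiv_Z {G : Type*} [Group G] [IsCyclic G] {n : ℕ} (h : Nat.card G = n) :
    Nonempty (G ≃* Z n) :=
  ⟨mulEquivOfCyclicCardEq (h.trans (card_Z n).symm)⟩

theorem nimGEN_of_isCyclic_of_card {G : Type*} [Group G] [Finite G] [IsCyclic G] {m : ℕ}
    (hm : Odd m) (h : Nat.card G = 2 * m) : nimGEN G = if m = 1 then 2 else 4 := by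
  have : NeZero m := ⟨hm.pos.ne'⟩
  have hcyc : IsCyclic (Z 2 × Z m) := Group.isCyclic_prod_iff.2
    ⟨inferInstance, inferInstance, by rw [card_Z, card_Z]; exact Nat.coprime_two_left.2 hm⟩
  have e : G ≃* Z 2 × Z m := mulEquivOfCyclicCardEq (by rw [h, Nat.card_prod, card_Z, card_Z])
  rw [nimGEN_congr e, nimGEN_prod_of_card_two_of_isCyclic (card_Z 2) (by rwa [card_Z]), card_Z]

instance isKleinFour_Z_two_prod : IsKleinFour (Z 2 × Z 2) where
  card_four := by rw [Nat.card_prod, card_Z]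
  exponent_two := by
    rw [Monoid.exponent_prod, IsCyclic.exponent_eq_card, card_Z]
    rfl

theorem exponent_eq_two {T : Type*} [Group T] [Nontrivial T] (h : ∀ t : T, t * t = 1) :
    Monoid.exponent T = 2 := by
  refine ((Nat.dvd_prime Nat.prime_two).1 (Monoid.exponent_dvd_of_forall_pow_eq_one
    fun t => (pow_two t).trans (h t))).resolve_left fun h1 => ?_
  exact not_subsingleton T (Monoid.exp_eq_one_iff.1 h1)

theorem card_dvd_four_of_exponent_two {T : Type*} [Group T] [Finite T]
    (h : Monoid.exponent T = 2) (hr : Group.rank T ≤ 2) : Nat.card T ∣ 4 := by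
  let _ : CommGroup T := { ‹Group T› with mul_comm := mul_comm_of_exponent_two h }
  have h1 := card_dvd_exponent_pow_rank T
  rw [h] at h1
  exact h1.trans (pow_dvd_pow 2 hr)

theorem rank_le_one_iff_isCyclic {G : Type*} [Group G] [Finite G] :
    Group.rank G ≤ 1 ↔ IsCyclic G := by
  rw [← generatesWith_empty_iff, generatesWith_empty_one_iff]

theorem nimGEN_prod_of_isCyclic_of_four_dvd {T H : Type*} [Group T] [Group H] [Finite T]
    [Finite H] (hT : IsPGroup 2 T) (hH : Odd (Nat.card H)) [IsCyclic (T × H)]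
    (h4 : 4 ∣ Nat.card (T × H)) : nimGEN (T × H) = 1 := by
  have hT4 : 4 ∣ Nat.card T := by
    rw [Nat.card_prod] at h4
    exact Nat.Coprime.dvd_of_dvd_mul_right
      (Nat.Coprime.pow_left 2 (Nat.coprime_two_left.2 hH)) h4
  have hcyc : IsCyclic T :=
    isCyclic_of_surjective (MonoidHom.fst T H) Prod.fst_surjective
  have hnt : Nontrivial T := Finite.one_lt_card_iff_nontrivial.1
    (by have := Nat.le_of_dvd Nat.card_pos hT4; omega)
  obtain ⟨t, ht⟩ : ∃ t : T, t * t ≠ 1 := by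
    by_contra! h
    have := exponent_eq_two h
    rw [IsCyclic.exponent_eq_card] at this
    omega
  exact (nimGEN_of_even_frattini (even_card_frattini_prod hT hH ht) inferInstance).1
    (rank_le_one_iff_isCyclic.2 ‹_›)

theorem nimGEN_prod_eq_zero_of_not_elementary {T H : Type*} [Group T] [Group H] [Finite T]
    [Finite H] (hT : IsPGroup 2 T) (hH : Odd (Nat.card H)) {t : T} (ht : t * t ≠ 1)
    (hG : ¬ ∃ k : ℕ, 1 ≤ k ∧ Nonempty (T × H ≃* Z (4 * k))) : nimGEN (T × H) = 0 := by
  have hnt : Nontrivial T := ⟨t * t, 1, ht⟩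
  refine (nimGEN_of_even_frattini (even_card_frattini_prod hT hH ht) inferInstance).2 ?_
  -- Rank at most 1 would make `T × H` cyclic, and `t * t ≠ 1` forces `4 ∣ |T|`, giving an excluded
  -- `Z (4 * k)`.
  by_contra! hlt
  have hcyc : IsCyclic (T × H) := rank_le_one_iff_isCyclic.1 (by omega)
  obtain ⟨n, hn⟩ := IsPGroup.iff_card.1 hT
  have h4 : 4 ∣ Nat.card (T × H) := by
    rw [Nat.card_prod]
    refine Dvd.dvd.mul_right ?_ _
    rw [hn]
    refine pow_dvd_pow 2 (n := n) (m := 2) ?_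
    by_contra! h2
    refine ht ?_
    rw [← pow_two, ← orderOf_dvd_iff_pow_eq_one]
    exact (orderOf_dvd_natCard t).trans (hn ▸ pow_dvd_pow 2 (Nat.lt_succ_iff.1 h2))
  obtain ⟨k, hk⟩ := h4
  have : 0 < Nat.card (T × H) := Nat.card_pos
  exact hG ⟨k, by omega, nonempty_mulEquiv_Z hk⟩

theorem nimGEN_prod_eq_zero_of_elementary {T H : Type*} [Group T] [Group H] [Finite T]
    [Finite H] [Nontrivial T] (hT : IsPGroup 2 T) (hH : Odd (Nat.card H))
    (ht : ∀ t : T, t * t = 1) (hK : ¬ (Nonempty (T × H ≃* (Z 2 × Z 2) × H) ∧ Group.rank H ≤ 2))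
    (h2 : ¬ Nonempty (T × H ≃* Z 2))
    (hG : ¬ ∃ k : ℕ, 1 ≤ k ∧ Nonempty (T × H ≃* Z (4 * k + 2))) : nimGEN (T × H) = 0 := by
  by_cases hr : 3 ≤ Group.rank (T × H)
  · exact nimGEN_prod_eq_zero_of_three_le_rank hT hH hr
  have hexp := exponent_eq_two ht
  have hrT := Group.rank_le_of_surjective (MonoidHom.fst T H) Prod.fst_surjective
  have hrH := Group.rank_le_of_surjective (MonoidHom.snd T H) Prod.snd_surjective
  have h4 := card_dvd_four_of_exponent_two hexp (hrT.trans (by omega))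
  have h1 : 1 < Nat.card T := Finite.one_lt_card
  have hle := Nat.le_of_dvd (by omega) h4
  have hcard : Nat.card T = 2 ∨ Nat.card T = 4 := by
    generalize Nat.card T = c at h4 h1 hle
    interval_cases c <;> omega
  rcases hcard with hcard | hcard
  · by_cases hcyc : IsCyclic H
    · have : Fact (Nat.Prime 2) := ⟨Nat.prime_two⟩
      have hcycT : IsCyclic T := isCyclic_of_prime_card hcard
      have hcyc' : IsCyclic (T × H) :=
        Group.isCyclic_prod_iff.2 ⟨hcycT, hcyc, coprime_card_of_isPGroup_two hT hH⟩
      obtain ⟨k, hk⟩ := hH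
      have hc : Nat.card (T × H) = 4 * k + 2 := by rw [Nat.card_prod, hcard, hk]; ring
      rcases Nat.eq_zero_or_pos k with rfl | hkpos
      · exact absurd (nonempty_mulEquiv_Z hc) h2
      · exact absurd ⟨k, hkpos, nonempty_mulEquiv_Z hc⟩ hG
    · exact nimGEN_prod_eq_zero_of_card_two hcard hH hcyc
  · have : IsKleinFour T := ⟨hcard, hexp⟩
    obtain ⟨e⟩ := IsKleinFour.nonempty_mulEquiv (G₁ := T) (G₂ := Z 2 × Z 2)
    exact absurd ⟨⟨e.prodCongr (MulEquiv.refl H)⟩, by omega⟩ hK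

end GenGame

/-- `Group.rank` is the minimum size `d` of a generating set. The first part computes `GEN(G)` for
every `G ≅ T × H` with `T` a finite `2`-group and `H` of odd order; the second part says that every
finite nilpotent group has this form. -/
theorem theorem4p9 :
    (∀ (G : Type*) (T : Type*) (H : Type*) [Group G] [Group T] [Group H]
        [Finite G] [Finite T] [Finite H],
      IsPGroup 2 T → Odd (Nat.card H) → Nonempty (G ≃* T × H) →
      (Odd (Nat.card G) ∧ 3 ≤ Group.rank G → GenGame.nimGEN G = 1) ∧
      ((∃ k : ℕ, 1 ≤ k ∧ Nonempty (G ≃* GenGame.Z (4 * k))) → GenGame.nimGEN G = 1) ∧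
      (Nonempty (G ≃* (GenGame.Z 2 × GenGame.Z 2) × H) ∧ Group.rank H ≤ 2 →
        GenGame.nimGEN G = 1) ∧
      (Nonempty (G ≃* GenGame.Z 2) → GenGame.nimGEN G = 2) ∧
      (Odd (Nat.card G) ∧ (Group.rank G = 1 ∨ Group.rank G = 2) → GenGame.nimGEN G = 2) ∧
      ((∃ k : ℕ, 1 ≤ k ∧ Nonempty (G ≃* GenGame.Z (4 * k + 2))) → GenGame.nimGEN G = 4) ∧
      (¬ (Odd (Nat.card G) ∧ 3 ≤ Group.rank G) →
        ¬ (∃ k : ℕ, 1 ≤ k ∧ Nonempty (G ≃* GenGame.Z (4 * k))) →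
        ¬ (Nonempty (G ≃* (GenGame.Z 2 × GenGame.Z 2) × H) ∧ Group.rank H ≤ 2) →
        ¬ Nonempty (G ≃* GenGame.Z 2) →
        ¬ (Odd (Nat.card G) ∧ (Group.rank G = 1 ∨ Group.rank G = 2)) →
        ¬ (∃ k : ℕ, 1 ≤ k ∧ Nonempty (G ≃* GenGame.Z (4 * k + 2))) →
        GenGame.nimGEN G = 0)) ∧
    (∀ (G : Type*) [Group G] [Finite G] [Group.IsNilpotent G],
      ∃ T H : Subgroup G, IsPGroup 2 T ∧ Odd (Nat.card H) ∧ Nonempty (G ≃* T × H)) := by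
  refine ⟨?_, fun G _ _ _ => GenGame.exists_mulEquiv_prod_of_isNilpotent G⟩
  intro G T H _ _ _ _ _ _ hT hH ⟨e⟩
  refine ⟨fun h => ?_, ?_, ?_, ?_, ?_, ?_, ?_⟩
  · exact (GenGame.nimGEN_of_odd_card h.1 (by omega)).2 h.2
  · rintro ⟨k, -, ⟨f⟩⟩
    have : IsCyclic (T × H) := (f.symm.trans e).isCyclic.1 inferInstance
    rw [GenGame.nimGEN_congr e]
    refine GenGame.nimGEN_prod_of_isCyclic_of_four_dvd hT hH ⟨k, ?_⟩
    rw [← Nat.card_congr (f.symm.trans e).toEquiv, GenGame.card_Z]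
  · rintro ⟨⟨f⟩, hr⟩
    rw [GenGame.nimGEN_congr f]
    exact GenGame.nimGEN_prod_of_isKleinFour hH hr
  · rintro ⟨f⟩
    have : IsCyclic G := f.isCyclic.2 inferInstance
    rw [GenGame.nimGEN_of_isCyclic_of_card (m := 1) odd_one
      (by rw [Nat.card_congr f.toEquiv, GenGame.card_Z]), if_pos rfl]
  · rintro ⟨hodd, hr⟩
    exact (GenGame.nimGEN_of_odd_card hodd (by omega)).1 (by omega)
  · rintro ⟨k, hk, ⟨f⟩⟩
    have : IsCyclic G := f.isCyclic.2 inferInstance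
    rw [GenGame.nimGEN_of_isCyclic_of_card (m := 2 * k + 1) ⟨k, rfl⟩
      (by rw [Nat.card_congr f.toEquiv, GenGame.card_Z]; ring), if_neg (by omega)]
  · intro h1 h2 h3 h4 h5 h6
    by_cases hodd : Odd (Nat.card G)
    -- The only odd-order group left is trivial, where the empty position already generates.
    · have hr : Group.rank G ≤ 0 := by
        by_contra! hr
        by_cases h : 3 ≤ Group.rank G
        · exact h1 ⟨hodd, h⟩
        · exact h5 ⟨hodd, by omega⟩
      exact GenGame.nim_of_closure_eq_top (GenGame.generatesWith_empty_iff.2 hr)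
    · have hnt : Nontrivial T := by
        by_contra hT1
        rw [not_nontrivial_iff_subsingleton] at hT1
        refine hodd ?_
        rwa [Nat.card_congr e.toEquiv, Nat.card_prod, Nat.card_of_subsingleton (1 : T), one_mul]
      have htrans : ∀ {X : Type} [Group X], Nonempty (T × H ≃* X) → Nonempty (G ≃* X) :=
        fun ⟨f⟩ => ⟨e.trans f⟩
      rw [GenGame.nimGEN_congr e]
      by_cases ht : ∃ t : T, t * t ≠ 1
      · obtain ⟨t, ht⟩ := ht
        exact GenGame.nimGEN_prod_eq_zero_of_not_elementary hT hH ht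
          fun ⟨k, hk, f⟩ => h2 ⟨k, hk, htrans f⟩
      · push Not at ht
        exact GenGame.nimGEN_prod_eq_zero_of_elementary hT hH ht
          (fun ⟨⟨f⟩, hr⟩ => h3 ⟨⟨e.trans f⟩, hr⟩) (fun f => h4 (htrans f))
          fun ⟨k, hk, f⟩ => h6 ⟨k, hk, htrans f⟩
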